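/- Let $\mathbb{H}$ be the real algebra of quaternions, let $\mathbb{S}=\{q\in\mathbb{H} : q^2=-1\}$ and, for $I\in\mathbb{S}$, let $L_I=\mathbb{R}+I\mathbb{R}$, which is identified with $\mathbb{C}$. A domain is a nonempty connected open set. A domain $\Omega\subseteq\mathbb{H}$ is called a slice domain if it intersects the real axis and $\Omega_I=\Omega\cap L_I$ is a domain in $L_I$ for every $I\in\mathbb{S}$; it is called symmetric if, for all $x,y\in\mathbb{R}$ and $I\in\mathbb{S}$ with $x+yI\in\Omega$, we have $x+yJ\in\Omega$ for all $J\in\mathbb{S}$. A function $f:\Omega\to\mathbb{H}$ is called regular if, for every $I\in\mathbb{S}$, the restriction $f_I=f|_{\Omega_I}$ is of class $C^1$ and $$\frac12\left(\frac{\partial}{\partial x}+I\frac{\partial}{\partial y}\right)f_I(x+yI)=0\quad\text{for all } x+yI\in\Omega_I.$$ **Theorem (Minimum Modulus Principle).** Let $\Omega\subseteq\mathbb{H}$ be a symmetric slice domain and let $f:\Omega\to\mathbb{H}$ be a regular function. If $|f|$ has a local minimum at a point $p\in\Omega$, then either $f(p)=0$ or $f$ is constant on $\Omega$. -/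

import Mathlib

namespace SliceRegular

/-- A domain: a (nonempty) connected open set. -/
def IsRegion {X : Type*} [TopologicalSpace X] (U : Set X) : Prop :=
  IsOpen U ∧ IsConnected U

/-- The sphere `𝕊` of quaternionic imaginary units. -/
def imaginaryUnits : Set (Quaternion ℝ) := {q | q ^ 2 = -1}

/-- For an imaginary unit `I`, the identification `x + i y ↦ x + y I` of `ℂ` with the complex
line `L_I = ℝ + I ℝ`. -/
noncomputable def sliceMap (I : Quaternion ℝ) (z : ℂ) : Quaternion ℝ :=
  (z.re : Quaternion ℝ) + (z.im : Quaternion ℝ) * I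

/-- The slice `Ω_I = Ω ∩ L_I`, read in `ℂ` through `sliceMap I`. -/
def slice (Ω : Set (Quaternion ℝ)) (I : Quaternion ℝ) : Set ℂ :=
  {z | sliceMap I z ∈ Ω}

/-- The restriction `f_I` of `f` to `L_I`, read in `ℂ` through `sliceMap I`. -/
noncomputable def sliceRestrict (f : Quaternion ℝ → Quaternion ℝ) (I : Quaternion ℝ) (z : ℂ) :
    Quaternion ℝ :=
  f (sliceMap I z)

/-- The operator `(1/2) (∂/∂x + I ∂/∂y)` applied to `f_I`, at the point `x + y I`,
where `z = x + i y`. -/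
noncomputable def dbar (I : Quaternion ℝ) (f : Quaternion ℝ → Quaternion ℝ) (z : ℂ) :
    Quaternion ℝ :=
  (1 / 2 : ℝ) • (fderiv ℝ (sliceRestrict f I) z 1
    + I * fderiv ℝ (sliceRestrict f I) z Complex.I)

/-- `f` is (slice) regular on the open set `Ω`: for each imaginary unit `I`, the restriction `f_I`
is of class `C¹` on `Ω_I` and is annihilated there by `(1/2) (∂/∂x + I ∂/∂y)`. Only the values of
`f` on `Ω` matter. -/
def IsRegularOn (f : Quaternion ℝ → Quaternion ℝ) (Ω : Set (Quaternion ℝ)) : Prop :=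
  ∀ I ∈ imaginaryUnits,
    ContDiffOn ℝ 1 (sliceRestrict f I) (slice Ω I) ∧ ∀ z ∈ slice Ω I, dbar I f z = 0

/-- A slice domain: a domain of `ℍ` that meets the real axis and whose slices `Ω_I` are all
domains of `L_I ≃ ℂ`. -/
structure IsSliceDomain (Ω : Set (Quaternion ℝ)) : Prop where
  isRegion : IsRegion Ω
  meets_real : ∃ x : ℝ, (x : Quaternion ℝ) ∈ Ω
  slice_isRegion : ∀ I ∈ imaginaryUnits, IsRegion (slice Ω I)

/-- Axial symmetry: if `x + y I ∈ C` then the whole of `x + y 𝕊` is contained in `C`. -/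
def IsAxiallySymmetric (C : Set (Quaternion ℝ)) : Prop :=
  ∀ x y : ℝ, ∀ I ∈ imaginaryUnits, (x : Quaternion ℝ) + (y : Quaternion ℝ) * I ∈ C →
    ∀ J ∈ imaginaryUnits, (x : Quaternion ℝ) + (y : Quaternion ℝ) * J ∈ C

end SliceRegular

/-!
Let `z₀ ∈ ℂ` correspond to `p` in a slice `L_I`, and consider `A_z w = w f(w⁻¹ (x + yI) w)` for
`z = x + iy` near `z₀` and `w` near `1`. For fixed `w` this is holomorphic in `z` for left
multiplication by `I`, and on the real axis it is `w f(x)`. Splitting `w = w₊ + w₋` into the parts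
that commute and anticommute with `I`, the identity principle therefore gives
`A_z w = w₊ f(x + yI) + w₋ f(x - yI)`, so `A_z` is a `ℂ`-linear operator that depends
holomorphically on `z`.

As `|f|` has a local minimum at `p`, the quotient `|A_z w| / |w|` has one at `(z₀, 1)`. If
`f p ≠ 0`, every `w` near `1` with `A_{z₀} w = f p` then has `|w| ≤ 1`; as the norm is strictly
convex, `A_{z₀}` is injective. Hence `A_z` is invertible near `z₀`, and `z ↦ A_z⁻¹ (f p)` has
locally maximal norm at `z₀`, so it is constant by the maximum modulus principle: `f = f p` on `L_I`
near `p`. The identity principle spreads this over `Ω_I`, in particular over the real points of `Ω`,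
and from there over every other slice.
-/

open Quaternion Filter Topology Set

namespace SliceRegular

section OperatorFamilies

theorem differentiableAt_clm_apply_iff {𝕜 D E F : Type*} [NontriviallyNormedField 𝕜]
    [CompleteSpace 𝕜] [NormedAddCommGroup D] [NormedSpace 𝕜 D] [NormedAddCommGroup E]
    [NormedSpace 𝕜 E] [FiniteDimensional 𝕜 E] [NormedAddCommGroup F] [NormedSpace 𝕜 F]
    {A : D → E →L[𝕜] F} {x : D} :
    DifferentiableAt 𝕜 A x ↔ ∀ v, DifferentiableAt 𝕜 (fun y => A y v) x := by
  refine ⟨fun h v => h.clm_apply (differentiableAt_const v), fun h => ?_⟩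
  let e : (E →L[𝕜] F) ≃L[𝕜] Fin (Module.finrank 𝕜 E) → F :=
    ((ContinuousLinearEquiv.ofFinrankEq (Module.finrank_fin_fun 𝕜).symm).arrowCongr
      (1 : F ≃L[𝕜] F)).trans (ContinuousLinearEquiv.piRing _)
  rw [← e.comp_differentiableAt_iff]
  exact differentiableAt_pi.2 fun i => h _

variable {M E : Type*} [NormedAddCommGroup M] [NormedAddCommGroup E] [NormedSpace ℂ E]
  {A : M → E →L[ℂ] E} {x₀ : M} {v : E}

theorem eventually_norm_le_of_isLocalMin_norm_div {X : Type*} {l : Filter X} {γ : X → M × E}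
    (hmin : IsLocalMin (fun p : M × E => ‖A p.1 p.2‖ / ‖p.2‖) (x₀, v)) (hv : A x₀ v ≠ 0)
    (hγ : Tendsto γ l (𝓝 (x₀, v))) (hA : ∀ᶠ t in l, A (γ t).1 (γ t).2 = A x₀ v) :
    ∀ᶠ t in l, ‖(γ t).2‖ ≤ ‖v‖ := by
  have hv0 : v ≠ 0 := by
    rintro rfl
    exact hv (map_zero _)
  filter_upwards [hγ.eventually hmin, hA] with t hle ht
  have hw : (γ t).2 ≠ 0 := by
    intro hw
    rw [hw, map_zero] at ht
    exact hv ht.symm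
  rw [ht] at hle
  exact (div_le_div_iff_of_pos_left (norm_pos_iff.2 hv) (norm_pos_iff.2 hv0)
    (norm_pos_iff.2 hw)).1 hle

theorem injective_of_isLocalMin_norm_div [StrictConvexSpace ℝ E]
    (hmin : IsLocalMin (fun p : M × E => ‖A p.1 p.2‖ / ‖p.2‖) (x₀, v)) (hv : A x₀ v ≠ 0) :
    Function.Injective (A x₀) := by
  refine (injective_iff_map_eq_zero _).2 fun w hw => ?_
  let γ : ℂ → M × E := fun t => (x₀, v + t • w)
  have hγ : Tendsto γ (𝓝 0) (𝓝 (x₀, v)) := by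
    have : Continuous γ := by fun_prop
    simpa [γ] using this.tendsto 0
  have hmax : IsLocalMax (norm ∘ fun t : ℂ => v + t • w) 0 := by
    filter_upwards [eventually_norm_le_of_isLocalMin_norm_div hmin hv hγ (by simp [γ, hw])]
      with t ht
    simpa [γ] using ht
  have hconst := Complex.eventually_eq_of_isLocalMax_norm
    (Eventually.of_forall fun t => by fun_prop) hmax
  obtain ⟨t, ht, ht0⟩ :=
    ((hconst.filter_mono nhdsWithin_le_nhds).and (self_mem_nhdsWithin (s := {0}ᶜ))).exists
  simpa [show t ≠ 0 from ht0] using ht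

/-- The solution `g x = (A x)⁻¹ (A x₀ v)` of `A x (g x) = A x₀ v` has maximal norm at `x₀`, so the
maximum modulus principle applies to it. -/
theorem eventually_apply_eq_of_isLocalMin_norm_div [NormedSpace ℂ M]
    [FiniteDimensional ℂ E] [StrictConvexSpace ℝ E] (hA : ∀ᶠ x in 𝓝 x₀, DifferentiableAt ℂ A x)
    (hmin : IsLocalMin (fun p : M × E => ‖A p.1 p.2‖ / ‖p.2‖) (x₀, v)) (hv : A x₀ v ≠ 0) :
    ∀ᶠ x in 𝓝 x₀, A x v = A x₀ v := by
  have : CompleteSpace E := FiniteDimensional.complete ℂ E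
  have hunit₀ : IsUnit (A x₀) := by
    have hinj := injective_of_isLocalMin_norm_div hmin hv
    exact ContinuousLinearMap.isUnit_iff_bijective.2
      ⟨hinj, LinearMap.surjective_of_injective (f := (A x₀ : E →ₗ[ℂ] E)) hinj⟩
  have hunit : ∀ᶠ x in 𝓝 x₀, IsUnit (A x) :=
    hA.self_of_nhds.continuousAt.eventually (Units.isOpen.mem_nhds hunit₀)
  let g : M → E := fun x => Ring.inverse (A x) (A x₀ v)
  have hg : ∀ᶠ x in 𝓝 x₀, DifferentiableAt ℂ g x := by
    filter_upwards [hA, hunit] with x hx hux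
    exact (hx.inverse hux).clm_apply (differentiableAt_const _)
  have hAg : ∀ᶠ x in 𝓝 x₀, A x (g x) = A x₀ v := by
    filter_upwards [hunit] with x hux
    exact congr($(Ring.mul_inverse_cancel _ hux) (A x₀ v))
  have hg₀ : g x₀ = v := congr($(Ring.inverse_mul_cancel _ hunit₀) v)
  have hγ : Tendsto (fun x => (x, g x)) (𝓝 x₀) (𝓝 (x₀, v)) := by
    simpa only [hg₀, id_eq] using tendsto_id.prodMk_nhds hg.self_of_nhds.continuousAt.tendsto
  have hmax : IsLocalMax (norm ∘ g) x₀ := by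
    simpa only [IsLocalMax, IsMaxFilter, Function.comp_apply, hg₀] using
      eventually_norm_le_of_isLocalMin_norm_div hmin hv hγ hAg
  filter_upwards [Complex.eventually_eq_of_isLocalMax_norm hg hmax, hAg] with x hx hAx
  rwa [hx, hg₀] at hAx

end OperatorFamilies

section ImaginaryUnits

variable {I : ℍ[ℝ]}

theorem mem_imaginaryUnits_iff : I ∈ imaginaryUnits ↔ I ^ 2 = -1 := Iff.rfl

theorem mul_self_of_mem_imaginaryUnits (hI : I ∈ imaginaryUnits) : I * I = -1 :=
  (sq I).symm.trans hI

theorem normSq_of_mem_imaginaryUnits (hI : I ∈ imaginaryUnits) : normSq I = 1 := by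
  have h : normSq I ^ 2 = 1 := by
    rw [← map_pow, mem_imaginaryUnits_iff.1 hI, normSq_neg, map_one]
  exact (pow_eq_one_iff_of_nonneg normSq_nonneg two_ne_zero).1 h

theorem re_of_mem_imaginaryUnits (hI : I ∈ imaginaryUnits) : I.re = 0 := by
  rw [← Quaternion.sq_eq_neg_normSq, normSq_of_mem_imaginaryUnits hI, coe_one]
  exact hI

theorem inv_mul_mul_mem_imaginaryUnits (hI : I ∈ imaginaryUnits) {w : ℍ[ℝ]} (hw : w ≠ 0) :
    w⁻¹ * I * w ∈ imaginaryUnits := by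
  calc (w⁻¹ * I * w) ^ 2 = w⁻¹ * I * (w * w⁻¹) * I * w := by noncomm_ring
    _ = w⁻¹ * (I * I) * w := by rw [mul_inv_cancel₀ hw]; noncomm_ring
    _ = -1 := by
      rw [mul_self_of_mem_imaginaryUnits hI, mul_neg_one, neg_mul, inv_mul_cancel₀ hw]

theorem norm_sliceMap (hI : I ∈ imaginaryUnits) (z : ℂ) : ‖sliceMap I z‖ = ‖z‖ := by
  have hcross : ((z.re : ℍ[ℝ]) * star ((z.im : ℍ[ℝ]) * I)).re = 0 := by
    simp [re_of_mem_imaginaryUnits hI]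
  rw [← sq_eq_sq₀ (norm_nonneg _) (norm_nonneg _), Complex.sq_norm, Complex.normSq_apply, sq,
    ← normSq_eq_norm_mul_self, sliceMap, normSq_add, hcross, map_mul,
    normSq_of_mem_imaginaryUnits hI, normSq_coe, normSq_coe]
  ring

theorem continuous_sliceMap (I : ℍ[ℝ]) : Continuous (sliceMap I) := by
  unfold sliceMap
  exact (continuous_coe.comp Complex.continuous_re).add
    ((continuous_coe.comp Complex.continuous_im).mul continuous_const)

theorem sliceMap_ofReal (I : ℍ[ℝ]) (x : ℝ) : sliceMap I x = x := by
  simp [sliceMap]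

theorem sliceMap_star (I : ℍ[ℝ]) (z : ℂ) : sliceMap I (star z) = sliceMap (-I) z := by
  simp [sliceMap]

theorem sliceMap_inv_mul_mul (I : ℍ[ℝ]) {w : ℍ[ℝ]} (hw : w ≠ 0) (z : ℂ) :
    sliceMap (w⁻¹ * I * w) z = w⁻¹ * sliceMap I z * w := by
  simp only [sliceMap, mul_add, add_mul, ← mul_assoc, ← coe_commutes _ w⁻¹]
  rw [mul_assoc (z.re : ℍ[ℝ]), inv_mul_cancel₀ hw, mul_one]

theorem ofReal_mem_slice_iff {Ω : Set ℍ[ℝ]} {x : ℝ} : (x : ℂ) ∈ slice Ω I ↔ (x : ℍ[ℝ]) ∈ Ω := by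
  rw [← sliceMap_ofReal I x]
  rfl

theorem isOpen_slice {Ω : Set ℍ[ℝ]} (hΩ : IsOpen Ω) (I : ℍ[ℝ]) : IsOpen (slice Ω I) :=
  hΩ.preimage (continuous_sliceMap I)

theorem exists_sliceMap_eq (q : ℍ[ℝ]) : ∃ I ∈ imaginaryUnits, ∃ z, sliceMap I z = q := by
  by_cases h : q.im = 0
  · refine ⟨ofComplex Complex.I, ?_, q.re, ?_⟩
    · rw [mem_imaginaryUnits_iff, ← map_pow, Complex.I_sq, map_neg, map_one]
    · rw [sliceMap_ofReal, ← add_zero (q.re : ℍ[ℝ]), ← h, re_add_im]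
  · have hn : ‖q.im‖ ≠ 0 := norm_ne_zero_iff.2 h
    refine ⟨‖q.im‖⁻¹ • q.im, ?_, ⟨q.re, ‖q.im‖⟩, ?_⟩
    · rw [mem_imaginaryUnits_iff, smul_pow, im_sq, normSq_eq_norm_mul_self, smul_neg,
        ← coe_smul, smul_eq_mul, ← sq, inv_pow, inv_mul_cancel₀ (pow_ne_zero 2 hn), coe_one]
    · rw [sliceMap, coe_mul_eq_smul, smul_smul, mul_inv_cancel₀ hn, one_smul, re_add_im]

theorem IsAxiallySymmetric.slice_eq {Ω : Set ℍ[ℝ]} (hΩ : IsAxiallySymmetric Ω) {J : ℍ[ℝ]}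
    (hI : I ∈ imaginaryUnits) (hJ : J ∈ imaginaryUnits) : slice Ω I = slice Ω J :=
  Set.ext fun z => ⟨fun h => hΩ z.re z.im I hI h J hJ, fun h => hΩ z.re z.im J hJ h I hI⟩

theorem IsAxiallySymmetric.star_mem_slice {Ω : Set ℍ[ℝ]} (hΩ : IsAxiallySymmetric Ω)
    (hI : I ∈ imaginaryUnits) {z : ℂ} (hz : z ∈ slice Ω I) : star z ∈ slice Ω I := by
  have hI' : -I ∈ imaginaryUnits := (neg_sq I).trans hI
  rw [hΩ.slice_eq hI hI'] at hz
  change sliceMap I (star z) ∈ Ω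
  rwa [sliceMap_star]

end ImaginaryUnits

section LeftComplexStructure

variable {I : ℍ[ℝ]} (hI : I ∈ imaginaryUnits)

/-- The complex normed space structure on `ℍ` in which `i` acts as left multiplication by the
imaginary unit `I`. It depends on `I`, hence is not an instance; its scalar action of `ℝ ⊆ ℂ` agrees
with the usual one only propositionally. -/
noncomputable abbrev leftComplexStructure : NormedSpace ℂ ℍ[ℝ] where
  toModule := Module.compHom ℍ[ℝ]
    (Complex.liftAux I (mul_self_of_mem_imaginaryUnits hI)).toRingHom
  norm_smul_le z q := by
    change ‖Complex.liftAux I (mul_self_of_mem_imaginaryUnits hI) z * q‖ ≤ _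
    rw [norm_mul, ← norm_sliceMap hI z, Complex.liftAux_apply, ← coe_mul_eq_smul]
    rfl

theorem leftComplexStructure_smul (z : ℂ) (q : ℍ[ℝ]) :
    letI := leftComplexStructure hI
    z • q = z.re • q + z.im • (I * q) := by
  change Complex.liftAux I (mul_self_of_mem_imaginaryUnits hI) z * q = _
  rw [Complex.liftAux_apply, add_mul, smul_mul_assoc]
  exact congr($(coe_mul_eq_smul _ _) + _)

theorem finiteDimensional_leftComplexStructure :
    letI := leftComplexStructure hI
    FiniteDimensional ℂ ℍ[ℝ] := by
  let := leftComplexStructure hI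
  exact Module.Finite.of_restrictScalars_finite ℝ ℂ ℍ[ℝ]

theorem strictConvexSpace_leftComplexStructure :
    letI := leftComplexStructure hI
    letI : NormedSpace ℝ ℍ[ℝ] := NormedSpace.complexToReal
    StrictConvexSpace ℝ ℍ[ℝ] := by
  have hne : ∀ ⦃x y : ℍ[ℝ]⦄, ‖x‖ = 1 → ‖y‖ = 1 → x ≠ y → ‖x + y‖ ≠ 2 := fun x y hx hy hxy h =>
    hxy (eq_of_norm_eq_of_norm_add_eq (hx.trans hy.symm) (by rw [h, hx, hy]; norm_num))
  let := leftComplexStructure hI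
  let : NormedSpace ℝ ℍ[ℝ] := NormedSpace.complexToReal
  exact StrictConvexSpace.of_norm_add_ne_two hne

end LeftComplexStructure

section LeftHolomorphic

/-- Holomorphy at `z` of a map `ℂ → ℍ`, where `i` acts on `ℍ` as left multiplication by `I`. It is
expressed by the Cauchy-Riemann equation for the real derivative, so that maps which are holomorphic
for different `I` can be compared. -/
def IsLeftHolomorphicAt (I : ℍ[ℝ]) (g : ℂ → ℍ[ℝ]) (z : ℂ) : Prop :=
  DifferentiableAt ℝ g z ∧ fderiv ℝ g z Complex.I = I * fderiv ℝ g z 1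

variable {I J : ℍ[ℝ]} {g h : ℂ → ℍ[ℝ]} {z : ℂ}

theorem isLeftHolomorphicAt_const (I a : ℍ[ℝ]) (z : ℂ) :
    IsLeftHolomorphicAt I (fun _ => a) z :=
  ⟨differentiableAt_const a, by simp⟩

theorem IsLeftHolomorphicAt.add (hg : IsLeftHolomorphicAt I g z) (hh : IsLeftHolomorphicAt I h z) :
    IsLeftHolomorphicAt I (fun z => g z + h z) z := by
  refine ⟨hg.1.add hh.1, ?_⟩
  rw [fderiv_fun_add hg.1 hh.1, add_apply, add_apply, hg.2, hh.2, mul_add]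

theorem IsLeftHolomorphicAt.const_mul {q : ℍ[ℝ]} (hq : I * q = q * J)
    (hg : IsLeftHolomorphicAt J g z) : IsLeftHolomorphicAt I (fun z => q * g z) z := by
  refine ⟨hg.1.const_mul q, ?_⟩
  rw [fderiv_const_mul hg.1, smul_apply, smul_apply, hg.2, smul_eq_mul, smul_eq_mul, ← mul_assoc,
    ← mul_assoc, hq]

theorem IsLeftHolomorphicAt.comp_star (hg : IsLeftHolomorphicAt I g (star z)) :
    IsLeftHolomorphicAt (-I) (fun z => g (star z)) z := by
  have hd : HasFDerivAt (fun z => g (star z))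
      ((fderiv ℝ g (star z)).comp (Complex.conjCLE : ℂ →L[ℝ] ℂ)) z :=
    hg.1.hasFDerivAt.comp z Complex.conjCLE.hasFDerivAt
  refine ⟨hd.differentiableAt, ?_⟩
  rw [hd.fderiv]
  simpa using hg.2

theorem IsLeftHolomorphicAt.differentiableAt (hI : I ∈ imaginaryUnits)
    (hg : IsLeftHolomorphicAt I g z) :
    letI := leftComplexStructure hI
    DifferentiableAt ℂ g z := by
  let := leftComplexStructure hI
  refine (hasFDerivAt_of_restrictScalars (𝕜 := ℝ) (𝕜' := ℂ)
    (f' := (1 : ℂ →L[ℂ] ℂ).smulRight (fderiv ℝ g z 1)) hg.1.hasFDerivAt ?_).differentiableAt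
  ext1 w
  calc w • fderiv ℝ g z 1 = fderiv ℝ g z (w.re • (1 : ℂ) + w.im • Complex.I) := by
        rw [leftComplexStructure_smul, ← hg.2, map_add, map_smul, map_smul]
    _ = fderiv ℝ g z w := by simp [Complex.re_add_im]

theorem IsRegularOn.isLeftHolomorphicAt {f : ℍ[ℝ] → ℍ[ℝ]} {Ω : Set ℍ[ℝ]} (hf : IsRegularOn f Ω)
    (hI : I ∈ imaginaryUnits) (hΩ : IsOpen Ω) {z : ℂ} (hz : z ∈ slice Ω I) :
    IsLeftHolomorphicAt I (sliceRestrict f I) z := by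
  obtain ⟨hd, hdbar⟩ := hf I hI
  refine ⟨(hd.differentiableOn one_ne_zero).differentiableAt ((isOpen_slice hΩ I).mem_nhds hz), ?_⟩
  have hz' := (smul_eq_zero_iff_right (by norm_num)).1 (hdbar z hz)
  rw [eq_neg_of_add_eq_zero_left hz', mul_neg, ← mul_assoc, mul_self_of_mem_imaginaryUnits hI,
    neg_one_mul, neg_neg]

variable {U : Set ℂ}

theorem IsLeftHolomorphicAt.eqOn_of_frequently_eq (hI : I ∈ imaginaryUnits) (hU : IsOpen U)
    (hc : IsPreconnected U) (hg : ∀ z ∈ U, IsLeftHolomorphicAt I g z)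
    (hh : ∀ z ∈ U, IsLeftHolomorphicAt I h z) (hz : z ∈ U)
    (heq : ∃ᶠ w in 𝓝[≠] z, g w = h w) : EqOn g h U := by
  let := leftComplexStructure hI
  have analyticOnNhd {k : ℂ → ℍ[ℝ]} (hk : ∀ z ∈ U, IsLeftHolomorphicAt I k z) :
      AnalyticOnNhd ℂ k U :=
    DifferentiableOn.analyticOnNhd
      (fun z hz => ((hk z hz).differentiableAt hI).differentiableWithinAt) hU
  exact (analyticOnNhd hg).eqOn_of_preconnected_of_frequently_eq (analyticOnNhd hh) hc hz heq

theorem IsLeftHolomorphicAt.eqOn_of_eq_ofReal (hI : I ∈ imaginaryUnits) (hU : IsOpen U)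
    (hc : IsPreconnected U) (hg : ∀ z ∈ U, IsLeftHolomorphicAt I g z)
    (hh : ∀ z ∈ U, IsLeftHolomorphicAt I h z) {x : ℝ} (hx : (x : ℂ) ∈ U)
    (heq : ∀ t : ℝ, (t : ℂ) ∈ U → g t = h t) : EqOn g h U := by
  have htendsto : Tendsto (fun t : ℝ => (t : ℂ)) (𝓝[≠] x) (𝓝[≠] (x : ℂ)) :=
    Complex.continuous_ofReal.continuousAt.continuousWithinAt.tendsto_nhdsWithin
      fun t ht => by simpa using ht
  have hmem : ∀ᶠ t : ℝ in 𝓝[≠] x, (t : ℂ) ∈ U :=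
    htendsto.eventually (nhdsWithin_le_nhds (hU.mem_nhds hx))
  exact eqOn_of_frequently_eq hI hU hc hg hh hx
    (htendsto.frequently (hmem.mono heq).frequently)

end LeftHolomorphic

section ConjEval

/-- The part of `w` that commutes with the imaginary unit `I`. -/
noncomputable def commPart (I w : ℍ[ℝ]) : ℍ[ℝ] := (1 / 2 : ℝ) • (w - I * w * I)

/-- The part of `w` that anticommutes with the imaginary unit `I`. -/
noncomputable def anticommPart (I w : ℍ[ℝ]) : ℍ[ℝ] := (1 / 2 : ℝ) • (w + I * w * I)

variable {I : ℍ[ℝ]}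

theorem commPart_add_anticommPart (I w : ℍ[ℝ]) : commPart I w + anticommPart I w = w := by
  rw [commPart, anticommPart, ← smul_add, sub_add_add_cancel, ← two_smul ℝ, smul_smul]
  norm_num

theorem mul_commPart (hI : I ∈ imaginaryUnits) (w : ℍ[ℝ]) :
    I * commPart I w = commPart I w * I := by
  have hII := mul_self_of_mem_imaginaryUnits hI
  simp only [commPart, mul_smul_comm, smul_mul_assoc, mul_sub, sub_mul, ← mul_assoc, hII]
  simp only [mul_assoc, hII]
  simp [add_comm]

theorem mul_anticommPart (hI : I ∈ imaginaryUnits) (w : ℍ[ℝ]) :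
    I * anticommPart I w = anticommPart I w * -I := by
  have hII := mul_self_of_mem_imaginaryUnits hI
  simp only [anticommPart, mul_smul_comm, smul_mul_assoc, mul_add, add_mul, ← mul_assoc, hII]
  simp only [mul_assoc, mul_neg, hII]
  simp [add_comm]

theorem commPart_add (I w w' : ℍ[ℝ]) : commPart I (w + w') = commPart I w + commPart I w' := by
  rw [commPart, commPart, commPart, ← smul_add]
  congr 1
  noncomm_ring

theorem anticommPart_add (I w w' : ℍ[ℝ]) :
    anticommPart I (w + w') = anticommPart I w + anticommPart I w' := by
  rw [anticommPart, anticommPart, anticommPart, ← smul_add]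
  congr 1
  noncomm_ring

theorem commPart_smul (hI : I ∈ imaginaryUnits) (z : ℂ) (w : ℍ[ℝ]) :
    letI := leftComplexStructure hI
    commPart I (z • w) = z • commPart I w := by
  simp only [leftComplexStructure_smul, commPart, mul_add, add_mul, mul_smul_comm, smul_mul_assoc,
    mul_sub, mul_assoc]
  module

theorem anticommPart_smul (hI : I ∈ imaginaryUnits) (z : ℂ) (w : ℍ[ℝ]) :
    letI := leftComplexStructure hI
    anticommPart I (z • w) = z • anticommPart I w := by
  simp only [leftComplexStructure_smul, anticommPart, mul_add, add_mul, mul_smul_comm,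
    smul_mul_assoc, mul_assoc]
  module

theorem commPart_one (hI : I ∈ imaginaryUnits) : commPart I 1 = 1 := by
  rw [commPart, mul_one, mul_self_of_mem_imaginaryUnits hI, sub_neg_eq_add, ← two_smul ℝ, smul_smul]
  norm_num

/-- The operator `w ↦ w₊ f(x + yI) + w₋ f(x - yI)`, where `z = x + iy` and `w₊`, `w₋` are the parts
of `w` that commute and anticommute with `I`; it is `ℂ`-linear for left multiplication by `I`. If
`f` is regular, its value is `w f(w⁻¹ (x + yI) w)` for `w ≠ 0`: it sees `f` off the slice `L_I`
and is holomorphic in `z`. -/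
noncomputable def conjEval (hI : I ∈ imaginaryUnits) (f : ℍ[ℝ] → ℍ[ℝ]) (z : ℂ) :
    letI := leftComplexStructure hI
    ℍ[ℝ] →L[ℂ] ℍ[ℝ] :=
  letI := leftComplexStructure hI
  haveI := finiteDimensional_leftComplexStructure hI
  LinearMap.toContinuousLinearMap
    { toFun := fun w => commPart I w * sliceRestrict f I z +
        anticommPart I w * sliceRestrict f I (star z)
      map_add' := fun w w' => by
        rw [commPart_add, anticommPart_add]
        noncomm_ring
      map_smul' := fun c w => by
        rw [commPart_smul hI, anticommPart_smul hI, RingHom.id_apply]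
        simp only [leftComplexStructure_smul, mul_add, add_mul, smul_mul_assoc, mul_assoc]
        module }

theorem conjEval_apply (hI : I ∈ imaginaryUnits) (f : ℍ[ℝ] → ℍ[ℝ]) (z : ℂ) (w : ℍ[ℝ]) :
    conjEval hI f z w =
      commPart I w * sliceRestrict f I z + anticommPart I w * sliceRestrict f I (star z) :=
  rfl

theorem conjEval_one (hI : I ∈ imaginaryUnits) (f : ℍ[ℝ] → ℍ[ℝ]) (z : ℂ) :
    conjEval hI f z 1 = sliceRestrict f I z := by
  have h := commPart_add_anticommPart I 1
  rw [commPart_one hI, add_eq_left] at h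
  rw [conjEval_apply, commPart_one hI, h, one_mul, zero_mul, add_zero]

variable {Ω : Set ℍ[ℝ]} {f : ℍ[ℝ] → ℍ[ℝ]}

theorem isLeftHolomorphicAt_conjEval_apply (hΩ : IsOpen Ω) (hsymm : IsAxiallySymmetric Ω)
    (hf : IsRegularOn f Ω) (hI : I ∈ imaginaryUnits) {z : ℂ} (hz : z ∈ slice Ω I) (w : ℍ[ℝ]) :
    IsLeftHolomorphicAt I (fun z => conjEval hI f z w) z :=
  ((hf.isLeftHolomorphicAt hI hΩ hz).const_mul (mul_commPart hI w)).add
    (((hf.isLeftHolomorphicAt hI hΩ (hsymm.star_mem_slice hI hz)).comp_star).const_mul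
      (mul_anticommPart hI w))

theorem conjEval_apply_eq (hΩ : IsSliceDomain Ω) (hsymm : IsAxiallySymmetric Ω)
    (hf : IsRegularOn f Ω) (hI : I ∈ imaginaryUnits) {z : ℂ} (hz : z ∈ slice Ω I) {w : ℍ[ℝ]}
    (hw : w ≠ 0) : conjEval hI f z w = w * f (w⁻¹ * sliceMap I z * w) := by
  have hJ := inv_mul_mul_mem_imaginaryUnits hI hw
  have hIJ := hsymm.slice_eq hI hJ
  obtain ⟨hU, hc⟩ := hΩ.slice_isRegion I hI
  obtain ⟨x, hx⟩ := hΩ.meets_real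
  have hconj : I * w = w * (w⁻¹ * I * w) := by
    rw [← mul_assoc, ← mul_assoc, mul_inv_cancel₀ hw, one_mul]
  rw [← sliceMap_inv_mul_mul I hw]
  refine IsLeftHolomorphicAt.eqOn_of_eq_ofReal hI hU hc.isPreconnected (x := x)
    (h := fun z => w * sliceRestrict f (w⁻¹ * I * w) z)
    (fun z hz => isLeftHolomorphicAt_conjEval_apply hΩ.isRegion.1 hsymm hf hI hz w)
    (fun z hz => (hf.isLeftHolomorphicAt hJ hΩ.isRegion.1 (hIJ ▸ hz)).const_mul hconj)
    (ofReal_mem_slice_iff.2 hx) (fun t _ => ?_) hz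
  have ht : star (t : ℂ) = t := Complex.conj_ofReal t
  simp only [conjEval_apply, sliceRestrict, ht, sliceMap_ofReal]
  rw [← add_mul, commPart_add_anticommPart]

theorem differentiableAt_conjEval (hΩ : IsOpen Ω) (hsymm : IsAxiallySymmetric Ω)
    (hf : IsRegularOn f Ω) (hI : I ∈ imaginaryUnits) {z : ℂ} (hz : z ∈ slice Ω I) :
    letI := leftComplexStructure hI
    DifferentiableAt ℂ (conjEval hI f) z := by
  let := leftComplexStructure hI
  have := finiteDimensional_leftComplexStructure hI
  exact differentiableAt_clm_apply_iff.2 fun w =>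
    (isLeftHolomorphicAt_conjEval_apply hΩ hsymm hf hI hz w).differentiableAt hI

theorem isLocalMin_norm_conjEval_div (hΩ : IsSliceDomain Ω) (hsymm : IsAxiallySymmetric Ω)
    (hf : IsRegularOn f Ω) (hI : I ∈ imaginaryUnits) {z₀ : ℂ} (hz₀ : z₀ ∈ slice Ω I)
    (hmin : IsLocalMinOn (fun q => ‖f q‖) Ω (sliceMap I z₀)) :
    IsLocalMin (fun p : ℂ × ℍ[ℝ] => ‖conjEval hI f p.1 p.2‖ / ‖p.2‖) (z₀, 1) := by
  let conj : ℂ × ℍ[ℝ] → ℍ[ℝ] := fun p => p.2⁻¹ * sliceMap I p.1 * p.2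
  have hconj : ContinuousAt conj (z₀, 1) :=
    ((continuousAt_snd.inv₀ one_ne_zero).mul
      ((continuous_sliceMap I).continuousAt.comp continuousAt_fst)).mul continuousAt_snd
  have hconj₀ : conj (z₀, 1) = sliceMap I z₀ := by simp [conj]
  have hlocal : IsLocalMin ((fun q => ‖f q‖) ∘ conj) (z₀, 1) := by
    refine IsLocalMin.comp_continuous ?_ hconj
    rw [hconj₀]
    exact hmin.isLocalMin (hΩ.isRegion.1.mem_nhds hz₀)
  have hslice : ∀ᶠ z in 𝓝 z₀, z ∈ slice Ω I := (isOpen_slice hΩ.isRegion.1 I).mem_nhds hz₀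
  refine hlocal.congr ?_
  filter_upwards [continuousAt_fst.eventually hslice,
    continuousAt_snd.eventually_ne (one_ne_zero (α := ℍ[ℝ]))] with p hz hw
  rw [conjEval_apply_eq hΩ hsymm hf hI hz hw, norm_mul,
    mul_div_cancel_left₀ _ (norm_ne_zero_iff.2 hw)]
  rfl

theorem eventually_sliceRestrict_eq_of_isLocalMinOn (hΩ : IsSliceDomain Ω)
    (hsymm : IsAxiallySymmetric Ω) (hf : IsRegularOn f Ω) (hI : I ∈ imaginaryUnits) {z₀ : ℂ}
    (hz₀ : z₀ ∈ slice Ω I) (hmin : IsLocalMinOn (fun q => ‖f q‖) Ω (sliceMap I z₀))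
    (h0 : f (sliceMap I z₀) ≠ 0) :
    ∀ᶠ z in 𝓝 z₀, sliceRestrict f I z = sliceRestrict f I z₀ := by
  let := leftComplexStructure hI
  have := finiteDimensional_leftComplexStructure hI
  have := strictConvexSpace_leftComplexStructure hI
  have hslice : ∀ᶠ z in 𝓝 z₀, z ∈ slice Ω I := (isOpen_slice hΩ.isRegion.1 I).mem_nhds hz₀
  have hconst := eventually_apply_eq_of_isLocalMin_norm_div
    (hslice.mono fun z hz => differentiableAt_conjEval hΩ.isRegion.1 hsymm hf hI hz)
    (isLocalMin_norm_conjEval_div hΩ hsymm hf hI hz₀ hmin) (by rwa [conjEval_one])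
  simpa only [conjEval_one] using hconst

theorem eqOn_const_of_eventually_sliceRestrict_eq (hΩ : IsSliceDomain Ω)
    (hsymm : IsAxiallySymmetric Ω) (hf : IsRegularOn f Ω) (hI : I ∈ imaginaryUnits) {z₀ : ℂ}
    (hz₀ : z₀ ∈ slice Ω I) {a : ℍ[ℝ]} (ha : ∀ᶠ z in 𝓝 z₀, sliceRestrict f I z = a) :
    EqOn f (fun _ => a) Ω := by
  have hI_const : EqOn (sliceRestrict f I) (fun _ => a) (slice Ω I) := by
    obtain ⟨hU, hc⟩ := hΩ.slice_isRegion I hI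
    exact IsLeftHolomorphicAt.eqOn_of_frequently_eq hI hU hc.isPreconnected
      (fun z hz => hf.isLeftHolomorphicAt hI hΩ.isRegion.1 hz)
      (fun z _ => isLeftHolomorphicAt_const I a z) hz₀
      (ha.filter_mono nhdsWithin_le_nhds).frequently
  intro q hq
  obtain ⟨J, hJ, z, rfl⟩ := exists_sliceMap_eq q
  obtain ⟨hU, hc⟩ := hΩ.slice_isRegion J hJ
  obtain ⟨x, hx⟩ := hΩ.meets_real
  refine IsLeftHolomorphicAt.eqOn_of_eq_ofReal (g := sliceRestrict f J) hJ hU hc.isPreconnected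
    (x := x) (fun z hz => hf.isLeftHolomorphicAt hJ hΩ.isRegion.1 hz)
    (fun z _ => isLeftHolomorphicAt_const J a z) (ofReal_mem_slice_iff.2 hx)
    (fun t ht => ?_) hq
  have h := hI_const (hsymm.slice_eq hJ hI ▸ ht)
  rwa [sliceRestrict, sliceMap_ofReal] at h ⊢

end ConjEval

end SliceRegular

theorem mainTheorem4 (Ω : Set (Quaternion ℝ)) (hΩ : SliceRegular.IsSliceDomain Ω)
    (hsymm : SliceRegular.IsAxiallySymmetric Ω)
    (f : Quaternion ℝ → Quaternion ℝ) (hf : SliceRegular.IsRegularOn f Ω)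
    (p : Quaternion ℝ) (hp : p ∈ Ω) (hmin : IsLocalMinOn (fun q => ‖f q‖) Ω p) :
    f p = 0 ∨ ∃ c : Quaternion ℝ, ∀ q ∈ Ω, f q = c := by
  refine or_iff_not_imp_left.2 fun hfp => ⟨f p, ?_⟩
  obtain ⟨I, hI, z₀, rfl⟩ := SliceRegular.exists_sliceMap_eq p
  exact SliceRegular.eqOn_const_of_eventually_sliceRestrict_eq hΩ hsymm hf hI hp
    (SliceRegular.eventually_sliceRestrict_eq_of_isLocalMinOn hΩ hsymm hf hI hp hmin hfp)
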